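/- Consider $n$ agents $v_1,\dots,v_n$ with an interaction digraph $G$ without self-loops. An edge $(v_i,v_j)$ means that $v_j$ is a neighbor of $v_i$ (agent $i$ receives information from agent $j$); $A=[a_{ij}]$ with $a_{ij}=1$ if $(v_i,v_j)$ is an edge and $a_{ij}=0$ otherwise, $d_i=\sum_j a_{ij}$, and $L=\mathrm{diag}(d_1,\dots,d_n)-A=[l_{ij}]$. Suppose that $G$ contains a spanning tree, i.e. there is a root node whose information reaches every other node along a directed path. The set of all roots is then a strongly connected component, the root component. Let $h>0$ be the sampling period, $\tau$ the delay, and let $0<\delta_i<\frac12$ and $\sigma_i$ be parameters of agent $i$. The agents obey $\dot x_i(t)=u_i(t)$ for $t\ge 0$, with arbitrary initial states $x_i(0)\in\mathbb R$ and $$u_i(t)=-\frac{\delta_i}{h d_i}\sum_{j=1}^n a_{ij}\,[\hat x_i(t-\tau)-\hat x_j(t-\tau)],\qquad t\ge\tau,$$ while $u_i(t)=0$ for $t<\tau$, and $u_i\equiv 0$ if $d_i=0$. Here $\hat x_i(t)=x_i(t^i)$, where $t^i$ is the last event time of agent $i$ not exceeding $t$. Time $0$ is an event time of every agent; the other event times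 are sampling times $mh$, $m\ge1$, and $mh$ is an event time of agent $i$ if and only if $$[x_i(mh)-\hat x_i((m-1)h)]^2-\frac{\sigma_i}{4d_i}\left(\hat q_i((m-1)h)+\hat q_i^{\,\prime}((m-1)h)\right)>0,$$ where $\hat q_i=-\sum_j l_{ij}(\hat x_i-\hat x_j)^2$ with the sum over the agents $j$ in the strongly connected component of $i$, and $\hat q_i^{\,\prime}$ is the same expression with the sum over all agents $j$ in the other components. (If $d_i=0$, then $x_i$ is constant and agent $i$ has no event after time $0$.) Assume that $$0<\sigma_i<1-2\delta_i\ \text{ for all } i,\qquad 0<\tau<h\beta,\qquad \beta=\min\Big\{1,\ \min_{1\le i\le n}\frac{1-2\delta_i-\sigma_i}{4\delta_i}\Big\}.$$ Then, for every sampling period $h>0$, consensus is reached asymptotically: $x_i(t)-x_j(t)\to0$ as $t\to\infty$ for all $i,j$. Moreover, the block of $L$ that belongs to the root component has a unique positive left eigenvector $\xi$ for the eigenvalue zero whose entries have sum $1$, and $\lim_{t\to\infty}x_i(t)=c$ for every $i$, where $$c=\frac{\sum_{i}\delta_i^{-1}d_i\,\xi_i\,x_i(0)}{\sum_{i}\delta_i^{-1}d_i\,\xi_i},$$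 with both sums over the agents of the root component; if the root component consists of a single agent $r$ (so that $d_r=0$), then $c=x_r(0)$. -/

import Mathlib

open Filter Topology

namespace EventConsensus

section Graph

variable {V : Type*} (G : Digraph V)

/-- A directed path from `a` to `b`. An edge `(v, w)` means that `w` is a neighbor of `v`, i.e. that
`v` receives the information of `w`; a directed path from `a` to `b` is therefore a chain of edges
`(b, v₁), (v₁, v₂), …, (v_m, a)` (the empty chain if `a = b`). -/
def HasPath (a b : V) : Prop := Relation.ReflTransGen G.Adj b a

/-- A root: there is a directed path from it to every node. -/
def IsRoot (r : V) : Prop := ∀ v, HasPath G r v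

/-- The digraph contains a spanning tree. -/
def HasSpanningTree : Prop := ∃ r, IsRoot G r

/-- Two nodes lie in the same strongly connected component. -/
def SameSCC (i j : V) : Prop := HasPath G i j ∧ HasPath G j i

/-- The nodes of the root component. If there is a spanning tree, the set of all roots is a strongly
connected component, the last one in any Perron-Frobenius ordering. -/
abbrev RootNode : Type _ := {v : V // IsRoot G v}

open Classical in
/-- The 0-1 adjacency matrix. -/
noncomputable def adjMat : Matrix V V ℝ := fun i j => if G.Adj i j then 1 else 0

variable [Fintype V]

/-- The in-degree `d_i = ∑ⱼ a_ij`. -/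
noncomputable def inDeg (i : V) : ℝ := ∑ j, adjMat G i j

open Classical in
/-- The Laplacian `L = D - A`. -/
noncomputable def lap : Matrix V V ℝ := Matrix.diagonal (inDeg G) - adjMat G

/-- The diagonal block of the Laplacian that belongs to the root component. -/
noncomputable def rootLap : Matrix (RootNode G) (RootNode G) ℝ :=
  (lap G).submatrix Subtype.val Subtype.val

open Classical in
/-- `ξ` is a positive left eigenvector of the root block of the Laplacian for the eigenvalue zero,
with entries of sum one. -/
def IsPositiveLeftNull (ξ : RootNode G → ℝ) : Prop :=
  (∀ i, 0 < ξ i) ∧ ∑ i, ξ i = 1 ∧ Matrix.vecMul ξ (rootLap G) = 0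

open Classical in
/-- The consensus value: the average of the initial states in the root component with the weights
`δ_i⁻¹ d_i ξ_i`. If the root component is a single agent (whose in-degree is `0`), it is the initial
state of that agent, written as a sum over the one-element component. -/
noncomputable def consensusValue (δ : V → ℝ) (ξ : RootNode G → ℝ) (x₀ : V → ℝ) : ℝ :=
  if Subsingleton (RootNode G) then ∑ i : RootNode G, x₀ i
  else (∑ i : RootNode G, (δ i)⁻¹ * inDeg G i * ξ i * x₀ i) /
    ∑ i : RootNode G, (δ i)⁻¹ * inDeg G i * ξ i

open Classical in
/-- `q̂_i^k = -∑ⱼ l_ij (y_i - y_j)²`, the sum over the agents `j` in the component of `i`. (The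
diagonal entry of the Laplacian block does not matter, since its factor is zero.) -/
noncomputable def qInner (y : V → ℝ) (i : V) : ℝ :=
  -∑ j, if SameSCC G i j then lap G i j * (y i - y j) ^ 2 else 0

open Classical in
/-- `q̂_i^{k,K} = -∑ⱼ l_ij (y_i - y_j)²`, the sum over the agents `j` in the other components. (In a
Perron-Frobenius ordering `l_ij = 0` for `j` in an earlier component, so that only the later
components contribute.) -/
noncomputable def qOuter (y : V → ℝ) (i : V) : ℝ :=
  -∑ j, if SameSCC G i j then 0 else lap G i j * (y i - y j) ^ 2

end Graph

section Dynamics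

variable {V : Type*}

open Classical in
/-- The held state `x̂_i(t) = x_i(t_l^i)`, where `t_l^i` is the last event time of agent `i` up to
time `t`. Event times are multiples of `h`, and `m ∈ E i` means that `m * h` is an event time of
agent `i`. -/
noncomputable def held (h : ℝ) (E : V → Set ℕ) (x : V → ℝ → ℝ) (t : ℝ) (i : V) : ℝ :=
  x i ((Nat.findGreatest (fun m => m ∈ E i) ⌊t / h⌋₊ : ℕ) * h)

variable [Fintype V] (G : Digraph V)

open Classical in
/-- The control input: zero before time `τ` and for agents without neighbors, else
`u_i(t) = -(δ_i / (h d_i)) ∑ⱼ a_ij (x̂_i(t - τ) - x̂_j(t - τ))`. -/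
noncomputable def controlInput (δ : V → ℝ) (h τ : ℝ) (E : V → Set ℕ) (x : V → ℝ → ℝ)
    (i : V) (t : ℝ) : ℝ :=
  if t < τ ∨ inDeg G i = 0 then 0
  else -(δ i / (h * inDeg G i)) *
    ∑ j, adjMat G i j * (held h E x (t - τ) i - held h E x (t - τ) j)

/-- The event condition of agent `i` at the sampling time `(m + 1) h`:
`e_i² - σ_i / (4 d_i) (q̂_i^k + q̂_i^{k,K}) > 0`, where `e_i = x_i((m + 1) h) - x̂_i(m h)`
is the error before the judgement, and the `q̂` are taken at the previous sampling time `m h`. -/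
def Triggers (σ : V → ℝ) (h : ℝ) (E : V → Set ℕ) (x : V → ℝ → ℝ) (i : V) (m : ℕ) : Prop :=
  (x i (((m + 1 : ℕ) : ℝ) * h) - held h E x (m * h) i) ^ 2 -
    σ i * (1 / (4 * inDeg G i)) *
      (qInner G (held h E x (m * h)) i + qOuter G (held h E x (m * h)) i) > 0

/-- `x` is a trajectory of the closed-loop system on `[0, ∞)` with the event times `E`. As the
control is piecewise constant and right-continuous, `ẋ_i = u_i` is required of the right-hand
derivative at every time, for a continuous `x_i`. -/
structure IsTrajectory (δ σ : V → ℝ) (h τ : ℝ) (E : V → Set ℕ) (x : V → ℝ → ℝ) : Prop where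
  continuousOn : ∀ i, ContinuousOn (x i) (Set.Ici 0)
  dynamics : ∀ i, ∀ t, 0 ≤ t → HasDerivWithinAt (x i) (controlInput G δ h τ E x i t) (Set.Ici t) t
  event_zero : ∀ i, 0 ∈ E i
  event_succ : ∀ i m, m + 1 ∈ E i ↔ Triggers G σ h E x i m

/-- `β = min {1, (1 - 2 δ_i - σ_i) / (4 δ_i)}`, the minimum over all agents `i`. -/
noncomputable def delayBound (δ σ : V → ℝ) : ℝ :=
  min 1 (⨅ i, (1 - 2 * δ i - σ i) / (4 * δ i))

/-- All agents approach each other asymptotically. -/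
def ReachesConsensus (x : V → ℝ → ℝ) : Prop :=
  ∀ i j, Tendsto (fun t => x i t - x j t) atTop (𝓝 0)

end Dynamics

end EventConsensus

/-!
The agents are followed at the switching times `k h + τ` of the control. Since `τ < h`, the control
is constant between two of them, so the states `y k` there satisfy `y (k + 1) = y k + v k`, where
`v k = increment (z k)` is computed from the held states `z k`. The states at the sampling time
`(k + 1) h` lag behind `y (k + 1)` by `(τ / h) v k`, and the triggering rule keeps them within
`(σᵢ / (4 dᵢ)) qᵢ(k)` of `z (k + 1)`, in the squared distance, where `qᵢ = ∑ⱼ a_ij (zᵢ - zⱼ)²` is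
the disagreement (`IsTrajectory.isSampledSystem`).

For nonnegative weights `p`, consider the energy `∑ᵢ pᵢ dᵢ δᵢ⁻¹ (yᵢ - b)²`, to which
`∑ᵢ pᵢ (σᵢ / 2 + δᵢ τ / h) qᵢ` of the previous step is added. Young's inequality for the triggering
error and for the delayed displacement shows that it decreases by at least
`∑ᵢ pᵢ ((1 - 2 δᵢ - σᵢ) / 2 - 2 δᵢ τ / h) qᵢ`, up to the term `-∑ⱼ (p L)ⱼ (zⱼ - b)²`; the
coefficients are positive exactly because `τ < h β`. Hence the disagreements are summable in time if
the exceptional terms with `(p L)ⱼ < 0` are (`IsSampledSystem.summable_disagreement`).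

This is used twice. With `p = ξ` on the root component and `0` elsewhere, `p L = 0`; the
disagreements of the roots are summable. As `∑ᵢ ξᵢ dᵢ δᵢ⁻¹ yᵢ` is invariant (a single root
never moves at all), the held states of the roots approach the consensus value `c` with square-summable error
(`IsSampledSystem.summable_sq_root`). There are also weights `p > 0` on all agents with
`(p L)ⱼ ≥ 0` for every `j` that is not a root (`exists_pos_vecMul_lap_nonneg`); with these and
`b = c`, the roots contribute a summable disturbance, and all disagreements are summable. Going
along a path to a root, every agent converges to `c` (`IsSampledSystem.tendsto`).

Both weight vectors are left null vectors of irreducible matrices with nonpositive off-diagonal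
entries and zero row sums: for such a matrix `|ζ|` is a left null vector whenever `ζ` is, and a
nonnegative left null vector is positive or zero (`existsUnique_pos_vecMul_eq_zero`).
-/

namespace EventConsensus

/-! ### Left null vectors of irreducible Laplacians -/

section LeftNull

variable {ι : Type*} [Fintype ι] {L : Matrix ι ι ℝ}

/-- The entries of `|ζ| L` are nonpositive because the off-diagonal entries of `L` are, and they sum
to zero because the rows of `L` do; hence they all vanish. -/
theorem vecMul_abs_eq_zero (hoff : ∀ i j, i ≠ j → L i j ≤ 0) (hrow : ∀ i, ∑ j, L i j = 0)
    {ζ : ι → ℝ} (hζ : Matrix.vecMul ζ L = 0) : Matrix.vecMul (fun i => |ζ i|) L = 0 := by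
  have hle : ∀ j, ∑ i, |ζ i| * L i j ≤ 0 := by
    intro j
    have h0 : ∑ i, ζ i * L i j = 0 := congrFun hζ j
    rcases abs_choice (ζ j) with hs | hs
    · rw [← h0]
      refine Finset.sum_le_sum fun i _ => ?_
      by_cases hij : i = j
      · rw [hij, hs]
      · exact mul_le_mul_of_nonpos_right (le_abs_self _) (hoff i j hij)
    · have h1 : ∑ i, -ζ i * L i j = 0 := by
        simp only [neg_mul, Finset.sum_neg_distrib, h0, neg_zero]
      rw [← h1]
      refine Finset.sum_le_sum fun i _ => ?_
      by_cases hij : i = j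
      · rw [hij, hs]
      · exact mul_le_mul_of_nonpos_right (neg_le_abs _) (hoff i j hij)
  have hsum : ∑ j, ∑ i, |ζ i| * L i j = 0 := by
    rw [Finset.sum_comm]
    simp only [← Finset.mul_sum, hrow, mul_zero, Finset.sum_const_zero]
  funext j
  exact (Finset.sum_eq_zero_iff_of_nonpos fun j _ => hle j).1 hsum j (Finset.mem_univ j)

/-- A zero entry of a nonnegative left null vector propagates against the edges, hence to every
index if `L` is irreducible. -/
theorem pos_or_eq_zero_of_vecMul_eq_zero (hoff : ∀ i j, i ≠ j → L i j ≤ 0)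
    (hirr : ∀ i j, Relation.ReflTransGen (fun a b => L a b < 0) i j)
    {ζ : ι → ℝ} (hnn : ∀ i, 0 ≤ ζ i) (hζ : Matrix.vecMul ζ L = 0) :
    (∀ i, 0 < ζ i) ∨ ζ = 0 := by
  by_cases hpos : ∀ i, 0 < ζ i
  · exact Or.inl hpos
  right
  push Not at hpos
  obtain ⟨j, hj⟩ := hpos
  have hstep : ∀ a b, L a b < 0 → ζ b = 0 → ζ a = 0 := by
    intro a b hab hb
    have h0 : ∑ i, ζ i * L i b = 0 := congrFun hζ b
    have hterm : ∀ i ∈ Finset.univ, ζ i * L i b ≤ 0 := by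
      intro i _
      by_cases hib : i = b
      · simp [hib, hb]
      · exact mul_nonpos_of_nonneg_of_nonpos (hnn i) (hoff i b hib)
    have := (Finset.sum_eq_zero_iff_of_nonpos hterm).1 h0 a (Finset.mem_univ a)
    exact (mul_eq_zero.1 this).resolve_right hab.ne
  funext i
  exact (hirr i j).head_induction_on (motive := fun a _ => ζ a = 0) (le_antisymm hj (hnn j))
    fun hab _ hb => hstep _ _ hab hb

theorem exists_pos_vecMul_eq_zero [Nonempty ι] (hoff : ∀ i j, i ≠ j → L i j ≤ 0)
    (hrow : ∀ i, ∑ j, L i j = 0) (hirr : ∀ i j, Relation.ReflTransGen (fun a b => L a b < 0) i j) :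
    ∃ ξ : ι → ℝ, (∀ i, 0 < ξ i) ∧ Matrix.vecMul ξ L = 0 := by
  classical
  have hdet : L.det = 0 := by
    refine Matrix.exists_mulVec_eq_zero_iff.1 ⟨1, one_ne_zero, ?_⟩
    funext i
    simpa [Matrix.mulVec, dotProduct] using hrow i
  obtain ⟨ζ, hζ0, hζ⟩ := Matrix.exists_vecMul_eq_zero_iff.2 hdet
  have habs := vecMul_abs_eq_zero hoff hrow hζ
  refine ⟨_, (pos_or_eq_zero_of_vecMul_eq_zero hoff hirr (fun i => abs_nonneg _) habs).resolve_right
    fun h => hζ0 ?_, habs⟩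
  funext i
  exact abs_eq_zero.1 (congrFun h i)

/-- If `ζ` is a left null vector, then so is the nonnegative vector `ζ + |ζ|`, which therefore
vanishes or is positive. So `ζ` cannot change sign, and vanishes if its entries sum to zero. -/
theorem eq_zero_of_vecMul_eq_zero_of_sum_eq_zero (hoff : ∀ i j, i ≠ j → L i j ≤ 0)
    (hrow : ∀ i, ∑ j, L i j = 0) (hirr : ∀ i j, Relation.ReflTransGen (fun a b => L a b < 0) i j)
    {ζ : ι → ℝ} (hζ : Matrix.vecMul ζ L = 0) (hsum : ∑ i, ζ i = 0) : ζ = 0 := by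
  have hadd : Matrix.vecMul (ζ + fun i => |ζ i|) L = 0 := by
    rw [Matrix.add_vecMul, hζ, vecMul_abs_eq_zero hoff hrow hζ, add_zero]
  rcases pos_or_eq_zero_of_vecMul_eq_zero hoff hirr
    (fun i => neg_le_iff_add_nonneg'.1 (neg_abs_le (ζ i)) |>.trans_eq (add_comm _ _)) hadd with h | h
  · have hpos : ∀ i ∈ Finset.univ, 0 ≤ ζ i := by
      intro i _
      by_contra! hneg
      have := h i
      simp [abs_of_neg hneg] at this
    funext i
    exact (Finset.sum_eq_zero_iff_of_nonneg hpos).1 hsum i (Finset.mem_univ i)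
  · have hneg : ∀ i ∈ Finset.univ, ζ i ≤ 0 := by
      intro i _
      have := congrFun h i
      simp only [Pi.zero_apply] at this
      linarith [abs_nonneg (ζ i)]
    funext i
    exact (Finset.sum_eq_zero_iff_of_nonpos hneg).1 hsum i (Finset.mem_univ i)

theorem existsUnique_pos_vecMul_eq_zero [Nonempty ι] (hoff : ∀ i j, i ≠ j → L i j ≤ 0)
    (hrow : ∀ i, ∑ j, L i j = 0) (hirr : ∀ i j, Relation.ReflTransGen (fun a b => L a b < 0) i j) :
    ∃! ξ : ι → ℝ, (∀ i, 0 < ξ i) ∧ ∑ i, ξ i = 1 ∧ Matrix.vecMul ξ L = 0 := by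
  obtain ⟨ξ, hpos, hnull⟩ := exists_pos_vecMul_eq_zero hoff hrow hirr
  have hs : 0 < ∑ i, ξ i := Finset.sum_pos (fun i _ => hpos i) Finset.univ_nonempty
  refine ⟨(∑ i, ξ i)⁻¹ • ξ, ⟨fun i => mul_pos (inv_pos.2 hs) (hpos i), ?_, ?_⟩, ?_⟩
  · simp only [Pi.smul_apply, smul_eq_mul, ← Finset.mul_sum]
    exact inv_mul_cancel₀ hs.ne'
  · rw [Matrix.smul_vecMul, hnull, smul_zero]
  · rintro η ⟨-, hη1, hη⟩
    refine sub_eq_zero.1 (eq_zero_of_vecMul_eq_zero_of_sum_eq_zero hoff hrow hirr ?_ ?_)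
    · rw [Matrix.sub_vecMul, hη, Matrix.smul_vecMul, hnull, smul_zero, sub_zero]
    · simp only [Pi.sub_apply, Pi.smul_apply, smul_eq_mul, Finset.sum_sub_distrib, ← Finset.mul_sum,
        hη1, inv_mul_cancel₀ hs.ne', sub_self]

end LeftNull

/-! ### The Laplacian of the digraph -/

section Graph

variable {V : Type*} {G : Digraph V}

theorem IsRoot.of_adj {i j : V} (hi : IsRoot G i) (hij : G.Adj i j) : IsRoot G j :=
  fun v => (hi v).tail hij

theorem adjMat_nonneg (i j : V) : 0 ≤ adjMat G i j := by
  unfold adjMat; split_ifs <;> norm_num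

theorem adjMat_of_adj {i j : V} (h : G.Adj i j) : adjMat G i j = 1 := if_pos h

theorem adjMat_of_isRoot {i j : V} (hi : IsRoot G i) (hj : ¬ IsRoot G j) : adjMat G i j = 0 :=
  if_neg fun h => hj (hi.of_adj h)

open Classical in
/-- A vector on the root component, extended by zero to all agents. -/
noncomputable def extendByZero (ξ : RootNode G → ℝ) (i : V) : ℝ :=
  if hi : IsRoot G i then ξ ⟨i, hi⟩ else 0

theorem extendByZero_coe (ξ : RootNode G → ℝ) (i : RootNode G) : extendByZero ξ i = ξ i :=
  dif_pos i.2

theorem extendByZero_of_not_isRoot (ξ : RootNode G → ℝ) {i : V} (hi : ¬ IsRoot G i) :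
    extendByZero ξ i = 0 := dif_neg hi

variable [Fintype V]

theorem inDeg_nonneg (i : V) : 0 ≤ inDeg G i := Finset.sum_nonneg fun j _ => adjMat_nonneg i j

theorem inDeg_pos_of_adj {i j : V} (h : G.Adj i j) : 0 < inDeg G i :=
  Finset.sum_pos' (fun j _ => adjMat_nonneg i j)
    ⟨j, Finset.mem_univ j, by rw [adjMat_of_adj h]; exact one_pos⟩

theorem lap_of_ne {i j : V} (h : i ≠ j) : lap G i j = -adjMat G i j := by
  classical
  simp [lap, Matrix.diagonal_apply_ne _ h]

theorem lap_nonpos_of_ne {i j : V} (h : i ≠ j) : lap G i j ≤ 0 := by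
  rw [lap_of_ne h]; exact neg_nonpos.2 (adjMat_nonneg i j)

theorem lap_mulVec_apply (f : V → ℝ) (i : V) :
    ∑ j, lap G i j * f j = ∑ j, adjMat G i j * (f i - f j) := by
  classical
  simp [lap, sub_mul, mul_sub, Finset.sum_sub_distrib, Matrix.diagonal_apply, inDeg,
    Finset.sum_mul]

theorem sum_lap (i : V) : ∑ j, lap G i j = 0 := by
  simpa using lap_mulVec_apply (G := G) (fun _ => 1) i

theorem lap_neg_of_adj (hloop : ∀ v, ¬ G.Adj v v) {i j : V} (h : G.Adj i j) : lap G i j < 0 := by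
  have hij : i ≠ j := by rintro rfl; exact hloop i h
  rw [lap_of_ne hij, adjMat_of_adj h]
  norm_num

theorem lap_of_isRoot {i j : V} (hi : IsRoot G i) (hj : ¬ IsRoot G j) : lap G i j = 0 := by
  have hij : i ≠ j := by rintro rfl; exact hj hi
  rw [lap_of_ne hij, adjMat_of_isRoot hi hj, neg_zero]

open Classical in
theorem sum_rootNode {f : V → ℝ} (hf : ∀ i, ¬ IsRoot G i → f i = 0) :
    ∑ i : RootNode G, f i = ∑ i, f i :=
  Finset.sum_of_injOn Subtype.val Subtype.val_injective.injOn (fun _ _ => Finset.mem_univ _)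
    (fun i _ hi => hf i fun h => hi ⟨⟨i, h⟩, Finset.mem_univ _, rfl⟩) fun _ _ => rfl

open Classical in
/-- The neighbors of a root are roots, so that the rows of the root block sum to zero. -/
theorem sum_rootLap (i : RootNode G) : ∑ j, rootLap G i j = 0 :=
  (sum_rootNode fun _ hj => lap_of_isRoot i.2 hj).trans (sum_lap i.1)

theorem rootLap_irreducible (hloop : ∀ v, ¬ G.Adj v v) (i j : RootNode G) :
    Relation.ReflTransGen (fun a b => rootLap G a b < 0) i j := by
  have key : ∀ b, Relation.ReflTransGen G.Adj i.1 b → ∃ hb : IsRoot G b,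
      Relation.ReflTransGen (fun a b => rootLap G a b < 0) i ⟨b, hb⟩ := by
    intro b hb
    induction hb with
    | refl => exact ⟨i.2, .refl⟩
    | tail _ hadj ih =>
      obtain ⟨hb, hpath⟩ := ih
      exact ⟨hb.of_adj hadj, hpath.tail (lap_neg_of_adj hloop hadj)⟩
  exact (key j.1 (j.2 i.1)).2

theorem existsUnique_isPositiveLeftNull (hloop : ∀ v, ¬ G.Adj v v) (htree : HasSpanningTree G) :
    ∃! ξ : RootNode G → ℝ, IsPositiveLeftNull G ξ := by
  classical
  obtain ⟨r, hr⟩ := htree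
  have : Nonempty (RootNode G) := ⟨⟨r, hr⟩⟩
  exact existsUnique_pos_vecMul_eq_zero
    (fun i j hij => lap_nonpos_of_ne fun h => hij (Subtype.ext h)) sum_rootLap
    (rootLap_irreducible hloop)

theorem extendByZero_vecMul_lap {ξ : RootNode G → ℝ} (hξ : IsPositiveLeftNull G ξ) (j : V) :
    ∑ i, extendByZero ξ i * lap G i j = 0 := by
  classical
  rw [← sum_rootNode (G := G) fun i hi => by rw [extendByZero_of_not_isRoot ξ hi, zero_mul]]
  simp only [extendByZero_coe]
  by_cases hj : IsRoot G j
  · exact congrFun hξ.2.2 ⟨j, hj⟩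
  · exact Finset.sum_eq_zero fun i _ => by rw [lap_of_isRoot i.2 hj, mul_zero]

/-- There are positive weights `p` such that `p L` is nonnegative outside the root component. They
form the left null vector of the Laplacian of the strongly connected digraph in which every root
listens to all agents: only the rows of the roots have changed. -/
theorem exists_pos_vecMul_lap_nonneg (hloop : ∀ v, ¬ G.Adj v v) (htree : HasSpanningTree G) :
    ∃ p : V → ℝ, (∀ i, 0 < p i) ∧ ∀ j, ¬ IsRoot G j → 0 ≤ ∑ i, p i * lap G i j := by
  classical
  obtain ⟨r, hr⟩ := htree
  have : Nonempty V := ⟨r⟩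
  let L' : Matrix V V ℝ := fun i j =>
    lap G i j + if IsRoot G i then (if i = j then (Fintype.card V : ℝ) else 0) - 1 else 0
  have hoff : ∀ i j, i ≠ j → L' i j ≤ lap G i j := by
    intro i j hij
    simp only [L', if_neg hij]
    split_ifs <;> norm_num
  have hroot : ∀ i j, IsRoot G i → i ≠ j → L' i j < 0 := by
    intro i j hi hij
    simp only [L', if_neg hij, if_pos hi]
    linarith [lap_nonpos_of_ne (G := G) hij]
  have hrow : ∀ i, ∑ j, L' i j = 0 := by
    intro i
    by_cases hi : IsRoot G i <;> simp [L', hi, Finset.sum_add_distrib, sum_lap]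
  have hirr : ∀ i j, Relation.ReflTransGen (fun a b => L' a b < 0) i j := by
    intro i j
    have h1 : Relation.ReflTransGen (fun a b => L' a b < 0) i r := by
      refine Relation.ReflTransGen.mono (fun a b hab => ?_) _ _ (hr i)
      have hne : a ≠ b := by rintro rfl; exact hloop a hab
      exact (hoff a b hne).trans_lt (lap_neg_of_adj hloop hab)
    by_cases hrj : r = j
    · exact hrj ▸ h1
    · exact h1.tail (hroot r j hr hrj)
  obtain ⟨p, hp, hnull⟩ := exists_pos_vecMul_eq_zero
    (fun i j hij => (hoff i j hij).trans (lap_nonpos_of_ne hij)) hrow hirr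
  refine ⟨p, hp, fun j hj => ?_⟩
  have h0 : ∑ i, p i * L' i j = 0 := congrFun hnull j
  rw [← h0]
  refine Finset.sum_le_sum fun i _ => mul_le_mul_of_nonneg_left ?_ (hp i).le
  by_cases hi : IsRoot G i
  · have hij : i ≠ j := by rintro rfl; exact hj hi
    exact hoff i j hij
  · simp [L', hi]

end Graph

/-! ### The sampled system and its Lyapunov function -/

section Sampled

variable {V : Type*} [Fintype V] {G : Digraph V}

variable (G) in
/-- The disagreement `∑ⱼ a_ij (z_i - z_j)²` of agent `i` with its neighbors. -/
noncomputable def disagreement (z : V → ℝ) (i : V) : ℝ := ∑ j, adjMat G i j * (z i - z j) ^ 2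

variable (G) in
/-- The displacement of agent `i` under the control of one sampling period, if `z` are the held
states; it is zero for an agent without neighbors. -/
noncomputable def increment (δ z : V → ℝ) (i : V) : ℝ :=
  -(δ i / inDeg G i) * ∑ j, adjMat G i j * (z i - z j)

theorem disagreement_nonneg (z : V → ℝ) (i : V) : 0 ≤ disagreement G z i :=
  Finset.sum_nonneg fun j _ => mul_nonneg (adjMat_nonneg i j) (sq_nonneg _)

theorem qInner_add_qOuter (z : V → ℝ) (i : V) :
    qInner G z i + qOuter G z i = disagreement G z i := by
  classical
  rw [qInner, qOuter, ← neg_add, ← Finset.sum_add_distrib, disagreement, ← Finset.sum_neg_distrib]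
  refine Finset.sum_congr rfl fun j _ => ?_
  by_cases hij : i = j
  · simp [hij]
  · rw [lap_of_ne hij]
    split_ifs <;> ring

theorem adjMat_eq_zero_of_inDeg_eq_zero {i : V} (hd : inDeg G i = 0) (j : V) : adjMat G i j = 0 :=
  (Finset.sum_eq_zero_iff_of_nonneg fun j _ => adjMat_nonneg i j).1 hd j (Finset.mem_univ j)

theorem inDeg_mul_increment (δ z : V → ℝ) (i : V) :
    inDeg G i * increment G δ z i = -δ i * ∑ j, adjMat G i j * (z i - z j) := by
  by_cases hd : inDeg G i = 0
  · simp [hd, adjMat_eq_zero_of_inDeg_eq_zero hd]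
  · rw [increment]
    field_simp

theorem inDeg_mul_sq_increment_le (δ z : V → ℝ) (i : V) :
    inDeg G i * increment G δ z i ^ 2 ≤ δ i ^ 2 * disagreement G z i := by
  by_cases hd : inDeg G i = 0
  · rw [hd, zero_mul]
    exact mul_nonneg (sq_nonneg _) (disagreement_nonneg z i)
  have hpos : 0 < inDeg G i := (inDeg_nonneg i).lt_of_ne' hd
  have hcs : (∑ j, adjMat G i j * (z i - z j)) ^ 2 ≤ inDeg G i * disagreement G z i :=
    Finset.sum_sq_le_sum_mul_sum_of_sq_le_mul _ (fun j _ => adjMat_nonneg i j)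
      (fun j _ => mul_nonneg (adjMat_nonneg i j) (sq_nonneg _)) fun j _ => le_of_eq (by ring)
  have heq : inDeg G i * increment G δ z i ^ 2
      = δ i ^ 2 * ((∑ j, adjMat G i j * (z i - z j)) ^ 2 / inDeg G i) := by
    rw [increment]
    field_simp
  rw [heq]
  refine mul_le_mul_of_nonneg_left ?_ (sq_nonneg _)
  rw [div_le_iff₀ hpos]
  linarith

/-- The cross term of the Lyapunov function: `2 ∑ᵢ pᵢ (zᵢ - b) (L z)ᵢ` is the weighted disagreement
up to a term that vanishes if `p` is a left null vector of the Laplacian. -/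
theorem two_mul_sum_mul_eq (p z : V → ℝ) (b : ℝ) :
    2 * ∑ i, p i * ((z i - b) * ∑ j, adjMat G i j * (z i - z j)) =
      ∑ i, p i * disagreement G z i + ∑ j, (∑ i, p i * lap G i j) * (z j - b) ^ 2 := by
  have hswap : ∑ j, (∑ i, p i * lap G i j) * (z j - b) ^ 2 =
      ∑ i, p i * ∑ j, adjMat G i j * ((z i - b) ^ 2 - (z j - b) ^ 2) := by
    simp only [Finset.sum_mul]
    rw [Finset.sum_comm]
    refine Finset.sum_congr rfl fun i _ => ?_
    rw [← lap_mulVec_apply (fun j => (z j - b) ^ 2), Finset.mul_sum]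
    exact Finset.sum_congr rfl fun j _ => by ring
  rw [hswap, ← Finset.sum_add_distrib, Finset.mul_sum]
  refine Finset.sum_congr rfl fun i _ => ?_
  rw [disagreement, ← mul_add, ← Finset.sum_add_distrib, Finset.mul_sum, Finset.mul_sum,
    Finset.mul_sum, Finset.mul_sum]
  exact Finset.sum_congr rfl fun j _ => by ring

/-- The discrete-time system behind a trajectory with delay `τ = θ h`: `z k` are the held states on
`[k h, (k + 1) h)` and `y k` the states at time `k h + τ`, from where on the control acts that was
computed from `z k`. The state at time `(k + 1) h` is `y (k + 1) - θ * increment (z k)`, and the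
triggering rule bounds its distance from `z (k + 1)`. For an agent without neighbors the
bound is zero by the convention for division, as is its true error. -/
structure IsSampledSystem (G : Digraph V) (δ σ : V → ℝ) (θ : ℝ) (z y : ℕ → V → ℝ) : Prop where
  step : ∀ k i, y (k + 1) i = y k i + increment G δ (z k) i
  error : ∀ k i, (y (k + 1) i - θ * increment G δ (z k) i - z (k + 1) i) ^ 2 ≤
    σ i * (1 / (4 * inDeg G i)) * disagreement G (z k) i

variable {δ σ : V → ℝ} {θ : ℝ} {z y : ℕ → V → ℝ}

/-- The change of the `i`-th summand of the Lyapunov function. Both the error and the delayed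
displacement are split off the state `y` by Young's inequality, the error with the weight `2 δᵢ`. -/
theorem IsSampledSystem.agent_le (hs : IsSampledSystem G δ σ θ z y) (hδ : ∀ i, 0 < δ i)
    (hσ : ∀ i, 0 < σ i) (hθ : 0 ≤ θ) {p : V → ℝ} (hp : ∀ i, 0 ≤ p i) (b : ℝ) (k : ℕ) (i : V) :
    p i * inDeg G i / δ i * (y (k + 2) i - b) ^ 2 ≤
      p i * inDeg G i / δ i * (y (k + 1) i - b) ^ 2
      - 2 * (p i * ((z (k + 1) i - b) * ∑ j, adjMat G i j * (z (k + 1) i - z (k + 1) j)))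
      + p i * ((1 / 2 + δ i + θ * δ i) * disagreement G (z (k + 1)) i)
      + p i * ((σ i / 2 + θ * δ i) * disagreement G (z k) i) := by
  have herr := hs.error k i
  have hv := inDeg_mul_sq_increment_le (G := G) δ (z k) i
  have hv' := inDeg_mul_sq_increment_le (G := G) δ (z (k + 1)) i
  have hS := inDeg_mul_increment (G := G) δ (z (k + 1)) i
  rw [hs.step (k + 1) i]
  set d := inDeg G i
  set v := increment G δ (z k) i
  set v' := increment G δ (z (k + 1)) i
  set q := disagreement G (z k) i
  set q' := disagreement G (z (k + 1)) i
  set S := ∑ j, adjMat G i j * (z (k + 1) i - z (k + 1) j)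
  obtain ⟨e, he⟩ : ∃ e, e = y (k + 1) i - θ * v - z (k + 1) i := ⟨_, rfl⟩
  rw [← he] at herr
  have hy : y (k + 1) i = z (k + 1) i + e + θ * v := by rw [he]; ring
  have hd : 0 ≤ d := inDeg_nonneg i
  have hq : 0 ≤ q := disagreement_nonneg _ i
  have hδi := hδ i
  have hde : 4 * (d * e ^ 2) ≤ σ i * q := by
    rcases hd.eq_or_lt with h0 | h0
    · rw [← h0, zero_mul, mul_zero]
      exact mul_nonneg (hσ i).le hq
    · calc 4 * (d * e ^ 2) ≤ 4 * (d * (σ i * (1 / (4 * d)) * q)) := by gcongr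
        _ = σ i * q := by field_simp
  have hmain : d * (2 * (e + θ * v) * v' + v' ^ 2) ≤
      δ i * ((1 / 2 + δ i + θ * δ i) * q' + (σ i / 2 + θ * δ i) * q) := by
    have h1 : d * (2 * δ i * (2 * e * v')) ≤ d * (4 * δ i ^ 2 * e ^ 2 + v' ^ 2) :=
      mul_le_mul_of_nonneg_left (by nlinarith [sq_nonneg (2 * δ i * e - v')]) hd
    have h2 : d * (2 * v * v') ≤ d * (v ^ 2 + v' ^ 2) :=
      mul_le_mul_of_nonneg_left (by nlinarith [sq_nonneg (v - v')]) hd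
    have h3 : d * (2 * e * v') ≤ δ i * (1 / 2 * q' + σ i / 2 * q) := by
      have h4 : δ i ^ 2 * (4 * (d * e ^ 2)) ≤ δ i ^ 2 * (σ i * q) :=
        mul_le_mul_of_nonneg_left hde (sq_nonneg _)
      refine le_of_mul_le_mul_left ?_ (by linarith : 0 < 2 * δ i)
      nlinarith
    have h5 : θ * (d * (2 * v * v')) ≤ θ * (δ i ^ 2 * (q + q')) :=
      mul_le_mul_of_nonneg_left (by linarith) hθ
    nlinarith
  have hw : p i * d / δ i * (2 * (e + θ * v) * v' + v' ^ 2) ≤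
      p i * ((1 / 2 + δ i + θ * δ i) * q' + (σ i / 2 + θ * δ i) * q) := by
    rw [mul_div_assoc, mul_assoc]
    refine mul_le_mul_of_nonneg_left ?_ (hp i)
    rw [div_mul_eq_mul_div, div_le_iff₀ hδi]
    linarith
  have hcross : p i * d / δ i * v' = -(p i * S) := by
    rw [mul_div_assoc, mul_assoc, div_mul_eq_mul_div, hS]
    field_simp
  have hexp : p i * d / δ i * (y (k + 1) i + v' - b) ^ 2 =
      p i * d / δ i * (y (k + 1) i - b) ^ 2
      + 2 * (z (k + 1) i - b) * (p i * d / δ i * v')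
      + p i * d / δ i * (2 * (e + θ * v) * v' + v' ^ 2) := by
    rw [hy]; ring
  rw [hexp, hcross]
  linarith

theorem summable_of_add_le {a W s : ℕ → ℝ} (ha : ∀ k, 0 ≤ a k) (hW : ∀ k, 0 ≤ W k)
    (hs : Summable s) (hs0 : ∀ k, 0 ≤ s k) (h : ∀ k, W (k + 1) + a k ≤ W k + s k) :
    Summable a := by
  have key : ∀ n, W n + ∑ k ∈ Finset.range n, a k ≤ W 0 + ∑ k ∈ Finset.range n, s k := by
    intro n
    induction n with
    | zero => simp
    | succ n ih =>
      rw [Finset.sum_range_succ, Finset.sum_range_succ]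
      linarith [h n]
  refine summable_of_sum_range_le (c := W 0 + ∑' k, s k) ha fun n => ?_
  linarith [key n, hW n, hs.sum_le_tsum (Finset.range n) fun k _ => hs0 k]

/-- The Lyapunov function `∑ᵢ pᵢ dᵢ δᵢ⁻¹ (yᵢ - b)²`, augmented by the disagreement of the previous
step, decreases by a multiple of the disagreement, except for the agents `j` at which `p L` is
negative; these have to be known to approach `b` already. -/
theorem IsSampledSystem.summable_disagreement (hs : IsSampledSystem G δ σ θ z y)
    (hδ : ∀ i, 0 < δ i) (hσ : ∀ i, 0 < σ i) (hθ : 0 ≤ θ)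
    (hdelay : ∀ i, 4 * δ i * θ < 1 - 2 * δ i - σ i) {p : V → ℝ} (hp : ∀ i, 0 ≤ p i) (b : ℝ)
    (hb : ∀ j, 0 ≤ ∑ i, p i * lap G i j ∨ Summable fun k => (z k j - b) ^ 2)
    {i : V} (hi : 0 < p i) : Summable fun k => disagreement G (z k) i := by
  let κ : V → ℝ := fun i => 1 / 2 - δ i - σ i / 2 - 2 * θ * δ i
  have hκ : ∀ i, 0 < κ i := fun i => by simp only [κ]; linarith [hdelay i]
  let W : ℕ → ℝ := fun k => ∑ i, p i * inDeg G i / δ i * (y (k + 1) i - b) ^ 2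
    + ∑ i, p i * ((σ i / 2 + θ * δ i) * disagreement G (z k) i)
  let s : ℕ → ℝ := fun k => ∑ j, max 0 (-∑ i, p i * lap G i j) * (z (k + 1) j - b) ^ 2
  let a : ℕ → ℝ := fun k => ∑ i, p i * (κ i * disagreement G (z (k + 1)) i)
  have hterm : ∀ k i, 0 ≤ p i * (κ i * disagreement G (z k) i) := fun k i =>
    mul_nonneg (hp i) (mul_nonneg (hκ i).le (disagreement_nonneg _ i))
  have ha : ∀ k, 0 ≤ a k := fun k => Finset.sum_nonneg fun i _ => hterm (k + 1) i
  have hW : ∀ k, 0 ≤ W k := by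
    intro k
    refine add_nonneg (Finset.sum_nonneg fun i _ => ?_) (Finset.sum_nonneg fun i _ => ?_)
    · exact mul_nonneg (div_nonneg (mul_nonneg (hp i) (inDeg_nonneg i)) (hδ i).le) (sq_nonneg _)
    · have := hδ i
      have := hσ i
      exact mul_nonneg (hp i) (mul_nonneg (by positivity) (disagreement_nonneg _ i))
  have hs0 : ∀ k, 0 ≤ s k := fun k => Finset.sum_nonneg fun j _ =>
    mul_nonneg (le_max_left _ _) (sq_nonneg _)
  have hsum : Summable s := by
    refine summable_sum fun j _ => ?_
    rcases hb j with h | h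
    · rw [max_eq_left (neg_nonpos.2 h)]
      simp
    · exact ((summable_nat_add_iff 1).2 h).mul_left _
  have hdec : ∀ k, W (k + 1) + a k ≤ W k + s k := by
    intro k
    have h1 := Finset.sum_le_sum fun i (_ : i ∈ Finset.univ) => hs.agent_le hδ hσ hθ hp b k i
    simp only [Finset.sum_add_distrib, Finset.sum_sub_distrib, ← Finset.mul_sum] at h1
    rw [two_mul_sum_mul_eq] at h1
    have h2 : -s k ≤ ∑ j, (∑ i, p i * lap G i j) * (z (k + 1) j - b) ^ 2 := by
      rw [← Finset.sum_neg_distrib]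
      refine Finset.sum_le_sum fun j _ => ?_
      rw [← neg_mul]
      exact mul_le_mul_of_nonneg_right (neg_le.1 (le_max_right _ _)) (sq_nonneg _)
    have h3 : ∑ i, p i * ((σ i / 2 + θ * δ i) * disagreement G (z (k + 1)) i) + a k
        + ∑ i, p i * ((1 / 2 + δ i + θ * δ i) * disagreement G (z (k + 1)) i)
        = ∑ i, p i * disagreement G (z (k + 1)) i := by
      simp only [a]
      rw [← Finset.sum_add_distrib, ← Finset.sum_add_distrib]
      refine Finset.sum_congr rfl fun i _ => ?_
      simp only [κ]
      ring
    simp only [W]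
    linarith
  have hasum := summable_of_add_le ha hW hsum hs0 hdec
  refine (summable_nat_add_iff 1).1 ?_
  have hi' : p i * κ i ≠ 0 := (mul_pos hi (hκ i)).ne'
  refine (summable_mul_left_iff hi').1 ?_
  refine Summable.of_nonneg_of_le (fun k => ?_) (fun k => ?_) hasum
  · simpa only [mul_assoc] using hterm (k + 1) i
  · rw [mul_assoc]
    exact Finset.single_le_sum (f := fun i => p i * (κ i * disagreement G (z (k + 1)) i))
      (fun i _ => hterm (k + 1) i) (Finset.mem_univ i)

end Sampled

/-! ### Convergence of the sampled system -/

section SampledLimit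

theorem summable_sq_add {f g : ℕ → ℝ} (hf : Summable fun k => f k ^ 2)
    (hg : Summable fun k => g k ^ 2) : Summable fun k => (f k + g k) ^ 2 :=
  Summable.of_nonneg_of_le (fun _ => sq_nonneg _)
    (fun k => by nlinarith [sq_nonneg (f k - g k)]) ((hf.mul_left 2).add (hg.mul_left 2))

theorem summable_sq_sub {f g : ℕ → ℝ} (hf : Summable fun k => f k ^ 2)
    (hg : Summable fun k => g k ^ 2) : Summable fun k => (f k - g k) ^ 2 := by
  simpa only [sub_eq_add_neg] using summable_sq_add hf (g := fun k => -g k) (by simpa using hg)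

theorem summable_sq_const_mul {f : ℕ → ℝ} (c : ℝ) (hf : Summable fun k => f k ^ 2) :
    Summable fun k => (c * f k) ^ 2 := by
  simpa only [mul_pow] using hf.mul_left (c ^ 2)

theorem summable_sq_sum {ι : Type*} {s : Finset ι} {f : ι → ℕ → ℝ}
    (hf : ∀ i ∈ s, Summable fun k => f i k ^ 2) : Summable fun k => (∑ i ∈ s, f i k) ^ 2 := by
  classical
  induction s using Finset.induction_on with
  | empty => simp
  | insert a s ha ih =>
    simp only [Finset.sum_insert ha]
    exact summable_sq_add (hf a (Finset.mem_insert_self a s))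
      (ih fun i hi => hf i (Finset.mem_insert_of_mem hi))

theorem tendsto_zero_of_summable_sq {f : ℕ → ℝ} (hf : Summable fun k => f k ^ 2) :
    Tendsto f atTop (𝓝 0) := by
  have h := hf.tendsto_atTop_zero.sqrt
  simp only [Real.sqrt_sq_eq_abs, Real.sqrt_zero] at h
  exact (tendsto_zero_iff_abs_tendsto_zero f).2 h

variable {V : Type*} [Fintype V] {G : Digraph V} {δ σ : V → ℝ} {θ : ℝ} {z y : ℕ → V → ℝ}

theorem summable_sq_sub_of_adj {i j : V} (hij : G.Adj i j)
    (hq : Summable fun k => disagreement G (z k) i) :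
    Summable fun k => (z k i - z k j) ^ 2 := by
  refine Summable.of_nonneg_of_le (fun _ => sq_nonneg _) (fun k => ?_) hq
  have h := Finset.single_le_sum (f := fun j => adjMat G i j * (z k i - z k j) ^ 2)
    (fun j _ => mul_nonneg (adjMat_nonneg i j) (sq_nonneg _)) (Finset.mem_univ j)
  rwa [adjMat_of_adj hij, one_mul] at h

theorem sq_increment_le (δ z : V → ℝ) (i : V) :
    increment G δ z i ^ 2 ≤ δ i ^ 2 / inDeg G i * disagreement G z i := by
  rcases (inDeg_nonneg (G := G) i).eq_or_lt with hd | hd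
  · simp [increment, ← hd]
  · rw [div_mul_eq_mul_div, le_div_iff₀ hd, mul_comm]
    exact inDeg_mul_sq_increment_le δ z i

theorem summable_sq_increment {i : V} (hq : Summable fun k => disagreement G (z k) i) :
    Summable fun k => increment G δ (z k) i ^ 2 :=
  Summable.of_nonneg_of_le (fun _ => sq_nonneg _) (fun k => sq_increment_le δ (z k) i)
    (hq.mul_left _)

theorem IsSampledSystem.summable_sq_state_sub (hs : IsSampledSystem G δ σ θ z y) {i : V}
    (hq : Summable fun k => disagreement G (z k) i) :
    Summable fun k => (y (k + 1) i - z (k + 1) i) ^ 2 := by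
  have h1 : Summable fun k => (y (k + 1) i - θ * increment G δ (z k) i - z (k + 1) i) ^ 2 :=
    Summable.of_nonneg_of_le (fun _ => sq_nonneg _) (fun k => hs.error k i) (hq.mul_left _)
  refine (summable_sq_add h1 (summable_sq_const_mul θ (summable_sq_increment (δ := δ) hq))).congr
    fun k => ?_
  ring

theorem inDeg_pos_of_isRoot [Nontrivial (RootNode G)] {i : V} (hi : IsRoot G i) :
    0 < inDeg G i := by
  obtain ⟨j, hj⟩ := exists_ne (⟨i, hi⟩ : RootNode G)
  rcases Relation.ReflTransGen.cases_head (j.2 i) with h | ⟨l, hl, -⟩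
  · exact absurd (Subtype.ext h.symm) hj
  · exact inDeg_pos_of_adj hl

open Classical in
/-- The consensus value is a weighted mean of the initial states of the roots, with positive weights
for which the weighted sum of the states is invariant. The weights are `δᵢ⁻¹ dᵢ ξᵢ`; for a single
root, where this vanishes, any weight will do. -/
theorem exists_conserved_weights (hδ : ∀ i, 0 < δ i) {ξ : RootNode G → ℝ}
    (hξ : IsPositiveLeftNull G ξ) :
    ∃ w : RootNode G → ℝ, (∀ i, 0 < w i) ∧
      (∀ z : V → ℝ, ∑ i : RootNode G, w i * increment G δ z i = 0) ∧
      ∀ x₀ : V → ℝ, (∑ i, w i) * consensusValue G δ ξ x₀ = ∑ i : RootNode G, w i * x₀ i := by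
  rcases subsingleton_or_nontrivial (RootNode G) with h | h
  · refine ⟨1, fun _ => one_pos, fun z => Finset.sum_eq_zero fun i _ => ?_, fun x₀ => ?_⟩
    · have : ∑ j, adjMat G i j * (z i - z j) = 0 := by
        refine Finset.sum_eq_zero fun j _ => ?_
        by_cases hj : IsRoot G j
        · have hij : i = ⟨j, hj⟩ := Subsingleton.elim _ _
          simp [hij]
        · rw [adjMat_of_isRoot i.2 hj, zero_mul]
      rw [increment, this, mul_zero, mul_zero]
    · rw [consensusValue, if_pos h]
      rcases isEmpty_or_nonempty (RootNode G) with he | ⟨⟨r⟩⟩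
      · simp
      · simp [Fintype.sum_subsingleton _ r]
  · have hpos : ∀ i : RootNode G, 0 < (δ i)⁻¹ * inDeg G i * ξ i := fun i =>
      mul_pos (mul_pos (inv_pos.2 (hδ i)) (inDeg_pos_of_isRoot i.2)) (hξ.1 i)
    refine ⟨fun i => (δ i)⁻¹ * inDeg G i * ξ i, hpos, fun z => ?_, fun x₀ => ?_⟩
    · have h1 : ∀ i : RootNode G, (δ i)⁻¹ * inDeg G i * ξ i * increment G δ z i =
          -(extendByZero ξ i * ∑ j, lap G i j * z j) := by
        intro i
        have := (hδ i).ne'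
        rw [lap_mulVec_apply, extendByZero_coe, mul_right_comm, mul_assoc (δ i)⁻¹,
          inDeg_mul_increment]
        field_simp
      have h2 : ∑ i, extendByZero ξ i * ∑ j, lap G i j * z j = 0 := by
        simp only [Finset.mul_sum]
        rw [Finset.sum_comm]
        refine Finset.sum_eq_zero fun j _ => ?_
        simp only [← mul_assoc]
        rw [← Finset.sum_mul, extendByZero_vecMul_lap hξ, zero_mul]
      rw [Finset.sum_congr rfl fun i _ => h1 i, Finset.sum_neg_distrib,
        sum_rootNode (f := fun i => extendByZero ξ i * ∑ j, lap G i j * z j) fun i hi => by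
          rw [extendByZero_of_not_isRoot ξ hi, zero_mul], h2, neg_zero]
    · rw [consensusValue, if_neg (not_subsingleton _)]
      exact mul_div_cancel₀ _ (Finset.sum_pos (fun i _ => hpos i) Finset.univ_nonempty).ne'

/-- Once the root component agrees up to square-summable errors, its held states approach the
weighted mean, which is invariant. -/
theorem IsSampledSystem.summable_sq_root (hs : IsSampledSystem G δ σ θ z y) (hδ : ∀ i, 0 < δ i)
    {ξ : RootNode G → ℝ} (hξ : IsPositiveLeftNull G ξ)
    (hq : ∀ i, IsRoot G i → Summable fun k => disagreement G (z k) i) {j : V} (hj : IsRoot G j) :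
    Summable fun k => (z k j - consensusValue G δ ξ (y 0)) ^ 2 := by
  classical
  obtain ⟨w, hw, hinv, hmean⟩ := exists_conserved_weights hδ hξ
  set c := consensusValue G δ ξ (y 0)
  have hW : 0 < ∑ i, w i := Finset.sum_pos (fun i _ => hw i) ⟨⟨j, hj⟩, Finset.mem_univ _⟩
  have hcons : ∀ k, ∑ i : RootNode G, w i * y k i = (∑ i, w i) * c := by
    intro k
    induction k with
    | zero => exact (hmean (y 0)).symm
    | succ k ih => simp only [hs.step, mul_add, Finset.sum_add_distrib, hinv, ih, add_zero]
  have hz : ∀ i, Relation.ReflTransGen G.Adj j i →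
      IsRoot G i ∧ Summable fun k => (z k j - z k i) ^ 2 := by
    intro i hi
    induction hi with
    | refl => exact ⟨hj, by simp⟩
    | tail _ hab ih =>
      obtain ⟨ha, hja⟩ := ih
      exact ⟨ha.of_adj hab,
        (summable_sq_add hja (summable_sq_sub_of_adj hab (hq _ ha))).congr fun k => by ring⟩
  refine (summable_nat_add_iff 1).1 ?_
  have hsum : Summable fun k => (∑ i : RootNode G, w i / (∑ i, w i) *
      ((z (k + 1) j - z (k + 1) i) - (y (k + 1) i - z (k + 1) i))) ^ 2 :=
    summable_sq_sum fun i _ => summable_sq_const_mul _ (summable_sq_sub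
      ((summable_nat_add_iff 1).2 (hz i (i.2 j)).2) (hs.summable_sq_state_sub (hq i i.2)))
  refine hsum.congr fun k => ?_
  congr 1
  have h1 : ∑ i : RootNode G, w i / (∑ i, w i) *
      ((z (k + 1) j - z (k + 1) i) - (y (k + 1) i - z (k + 1) i)) =
      (∑ i, w i)⁻¹ * ((∑ i, w i) * z (k + 1) j - ∑ i : RootNode G, w i * y (k + 1) i) := by
    rw [Finset.sum_mul, ← Finset.sum_sub_distrib, Finset.mul_sum]
    exact Finset.sum_congr rfl fun i _ => by ring
  rw [h1, hcons, ← mul_sub, inv_mul_cancel_left₀ hW.ne']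

/-- The Lyapunov estimate is used twice: for the root component, with the weights `ξ`, and then for
all agents, where the roots act as a disturbance that is already known to be summable. -/
theorem IsSampledSystem.tendsto (hs : IsSampledSystem G δ σ θ z y) (hloop : ∀ v, ¬ G.Adj v v)
    (htree : HasSpanningTree G) (hδ : ∀ i, 0 < δ i) (hσ : ∀ i, 0 < σ i) (hθ : 0 ≤ θ)
    (hdelay : ∀ i, 4 * δ i * θ < 1 - 2 * δ i - σ i) {ξ : RootNode G → ℝ}
    (hξ : IsPositiveLeftNull G ξ) (i : V) :
    Tendsto (fun k => y k i) atTop (𝓝 (consensusValue G δ ξ (y 0))) ∧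
      Tendsto (fun k => increment G δ (z k) i) atTop (𝓝 0) := by
  set c := consensusValue G δ ξ (y 0)
  have hqroot : ∀ j, IsRoot G j → Summable fun k => disagreement G (z k) j := by
    intro j hj
    refine hs.summable_disagreement hδ hσ hθ hdelay (p := extendByZero ξ) (fun l => ?_) 0
      (fun l => Or.inl (extendByZero_vecMul_lap hξ l).ge) ?_
    · by_cases hl : IsRoot G l
      · exact (extendByZero_coe ξ ⟨l, hl⟩ ▸ hξ.1 ⟨l, hl⟩).le
      · exact (extendByZero_of_not_isRoot ξ hl).ge
    · exact extendByZero_coe ξ ⟨j, hj⟩ ▸ hξ.1 ⟨j, hj⟩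
  obtain ⟨p, hp, hpL⟩ := exists_pos_vecMul_lap_nonneg hloop htree
  have hq : ∀ j, Summable fun k => disagreement G (z k) j := fun j =>
    hs.summable_disagreement hδ hσ hθ hdelay (fun l => (hp l).le) c
      (fun l => (em (IsRoot G l)).symm.imp (hpL l) fun hl => hs.summable_sq_root hδ hξ hqroot hl)
      (hp j)
  have hz : Summable fun k => (z k i - c) ^ 2 := by
    obtain ⟨r, hr⟩ := htree
    refine (hr i).head_induction_on (motive := fun a _ => Summable fun k => (z k a - c) ^ 2)
      (hs.summable_sq_root hδ hξ hqroot hr) fun {a b} hab _ ih => ?_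
    exact (summable_sq_add (summable_sq_sub_of_adj hab (hq a)) ih).congr fun k => by ring
  refine ⟨(tendsto_add_atTop_iff_nat 1).1 (tendsto_sub_nhds_zero_iff.1
    (tendsto_zero_of_summable_sq ?_)), tendsto_zero_of_summable_sq (summable_sq_increment (hq i))⟩
  exact (summable_sq_add (hs.summable_sq_state_sub (hq i)) ((summable_nat_add_iff 1).2 hz)).congr
    fun k => by ring

end SampledLimit

/-! ### From trajectories to the sampled system -/

section Trajectory

/-- Mean value property for right-hand derivatives: constant speed means affine motion. -/
theorem eq_add_mul_of_hasDerivWithinAt_Ici {f : ℝ → ℝ} {a b C : ℝ}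
    (hf : ContinuousOn f (Set.Icc a b))
    (hd : ∀ t ∈ Set.Ico a b, HasDerivWithinAt f C (Set.Ici t) t) :
    ∀ t ∈ Set.Icc a b, f t = f a + C * (t - a) := by
  intro t ht
  have h := constant_of_has_deriv_right_zero (f := fun t => f t - C * (t - a))
    (hf.sub (by fun_prop)) (fun s hs => ?_) t ht
  · simp only [sub_self, mul_zero, sub_zero] at h
    linarith
  · have h1 := (hd s hs).sub ((((hasDerivAt_id s).sub_const a).const_mul C).hasDerivWithinAt
      (s := Set.Ici s))
    simpa only [mul_one, sub_self] using! h1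

variable {V : Type*} {h τ : ℝ} {E : V → Set ℕ} {x : V → ℝ → ℝ}

theorem held_eq_of_mem (hh : 0 < h) {k : ℕ} {s : ℝ} (h1 : k * h ≤ s) (h2 : s < (k + 1) * h)
    (i : V) : held h E x s i = held h E x (k * h) i := by
  have hs : ⌊s / h⌋₊ = k := by
    rw [Nat.floor_eq_iff (div_nonneg ((by positivity : (0 : ℝ) ≤ k * h).trans h1) hh.le),
      le_div_iff₀ hh, div_lt_iff₀ hh]
    exact ⟨h1, h2⟩
  rw [held, held, hs, mul_div_cancel_right₀ _ hh.ne', Nat.floor_natCast]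

theorem held_of_mem (hh : 0 < h) {k : ℕ} {i : V} (hk : k ∈ E i) :
    held h E x (k * h) i = x i (k * h) := by
  classical
  rw [held, mul_div_cancel_right₀ _ hh.ne', Nat.floor_natCast, Nat.findGreatest_eq hk]

theorem held_succ_of_not_mem (hh : 0 < h) {k : ℕ} {i : V} (hk : k + 1 ∉ E i) :
    held h E x ((k + 1 : ℕ) * h) i = held h E x (k * h) i := by
  classical
  rw [held, held, mul_div_cancel_right₀ _ hh.ne', mul_div_cancel_right₀ _ hh.ne',
    Nat.floor_natCast, Nat.floor_natCast, Nat.findGreatest_of_not hk]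

variable [Fintype V] {G : Digraph V} {δ σ : V → ℝ}

theorem controlInput_eq_of_mem (hh : 0 < h) {k : ℕ} {t : ℝ}
    (ht : t ∈ Set.Ico (k * h + τ) ((k + 1) * h + τ)) (i : V) :
    controlInput G δ h τ E x i t = increment G δ (held h E x (k * h)) i / h := by
  have hk : (0 : ℝ) ≤ k * h := by positivity
  have hheld : held h E x (t - τ) = held h E x (k * h) :=
    funext (held_eq_of_mem hh (by linarith [ht.1]) (by linarith [ht.2]))
  rw [controlInput, increment, hheld]
  by_cases hd : inDeg G i = 0
  · simp [hd]
  · rw [if_neg (not_or.2 ⟨by linarith [ht.1], hd⟩)]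
    field_simp

/-- After the delay `τ`, the states are affine between the switching times `k h + τ`. -/
theorem IsTrajectory.eq_of_mem (hx : IsTrajectory G δ σ h τ E x) (hh : 0 < h) (hτ : 0 < τ) {k : ℕ}
    {t : ℝ} (ht : t ∈ Set.Icc (k * h + τ) ((k + 1) * h + τ)) (i : V) :
    x i t = x i (k * h + τ) +
      increment G δ (held h E x (k * h)) i * ((t - (k * h + τ)) / h) := by
  have hk : (0 : ℝ) ≤ k * h := by positivity
  rw [eq_add_mul_of_hasDerivWithinAt_Ici
    ((hx.continuousOn i).mono fun s hs => (by linarith [hs.1] : (0 : ℝ) ≤ s))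
    (fun s hs => controlInput_eq_of_mem hh hs i ▸ hx.dynamics i s (by linarith [hs.1])) t ht]
  ring

theorem IsTrajectory.eq_initial (hx : IsTrajectory G δ σ h τ E x) (hτ : 0 < τ) (i : V) :
    x i τ = x i 0 := by
  have h1 := eq_add_mul_of_hasDerivWithinAt_Ici (C := 0)
    ((hx.continuousOn i).mono Set.Icc_subset_Ici_self)
    (fun s hs => ?_) τ ⟨hτ.le, le_rfl⟩
  · simpa using h1
  · have h2 := hx.dynamics i s hs.1
    rwa [controlInput, if_pos (Or.inl hs.2)] at h2

theorem IsTrajectory.isSampledSystem (hx : IsTrajectory G δ σ h τ E x) (hh : 0 < h) (hτ : 0 < τ)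
    (hτh : τ < h) (hσ : ∀ i, 0 < σ i) :
    IsSampledSystem G δ σ (τ / h) (fun k => held h E x (k * h)) (fun k i => x i (k * h + τ)) := by
  have hstep : ∀ (k : ℕ) i, x i ((k + 1 : ℕ) * h + τ) =
      x i (k * h + τ) + increment G δ (held h E x (k * h)) i := by
    intro k i
    push_cast
    rw [hx.eq_of_mem hh hτ (k := k) ⟨by linarith, le_rfl⟩ i]
    field_simp
    ring
  refine ⟨hstep, fun k i => ?_⟩
  -- The sampling time `(k + 1) h` precedes the next switching time `(k + 1) h + τ`.
  have hsample : x i ((k + 1 : ℕ) * h + τ) - τ / h * increment G δ (held h E x (k * h)) i =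
      x i ((k + 1 : ℕ) * h) := by
    rw [hstep, hx.eq_of_mem hh hτ (k := k) (t := (k + 1 : ℕ) * h)
      ⟨by push_cast; linarith, by push_cast; linarith⟩ i]
    push_cast
    field_simp
    ring
  simp only [hsample]
  by_cases hk : k + 1 ∈ E i
  · rw [held_of_mem hh hk, sub_self, zero_pow two_ne_zero]
    exact mul_nonneg (mul_nonneg (hσ i).le (by have := inDeg_nonneg (G := G) i; positivity))
      (disagreement_nonneg _ _)
  · have htr := (hx.event_succ i k).not.1 hk
    rw [Triggers, qInner_add_qOuter, gt_iff_lt, sub_pos, not_lt] at htr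
    rwa [held_succ_of_not_mem hh hk]

theorem IsTrajectory.tendsto (hx : IsTrajectory G δ σ h τ E x) (hh : 0 < h) (hτ : 0 < τ) {i : V}
    {c : ℝ} (hy : Tendsto (fun k : ℕ => x i (k * h + τ)) atTop (𝓝 c))
    (hv : Tendsto (fun k : ℕ => increment G δ (held h E x (k * h)) i) atTop (𝓝 0)) :
    Tendsto (x i) atTop (𝓝 c) := by
  have hfloor : Tendsto (fun t : ℝ => ⌊(t - τ) / h⌋₊) atTop atTop :=
    tendsto_nat_floor_atTop.comp
      ((tendsto_atTop_add_const_right atTop (-τ) tendsto_id).atTop_div_const hh)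
  have hbound : Tendsto (fun k : ℕ => |x i (k * h + τ) - c|
      + |increment G δ (held h E x (k * h)) i|) atTop (𝓝 0) := by
    simpa using (tendsto_sub_nhds_zero_iff.2 hy).abs.add hv.abs
  refine tendsto_iff_norm_sub_tendsto_zero.2 (squeeze_zero' (Eventually.of_forall fun t =>
    norm_nonneg _) ?_ (hbound.comp hfloor))
  filter_upwards [eventually_ge_atTop τ] with t ht
  simp only [Function.comp_apply]
  set k := ⌊(t - τ) / h⌋₊
  have h1 : (k : ℝ) * h ≤ t - τ :=
    (le_div_iff₀ hh).1 (Nat.floor_le (div_nonneg (by linarith) hh.le))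
  have h2 : t - τ < (k + 1) * h := (div_lt_iff₀ hh).1 (Nat.lt_floor_add_one _)
  have h3 : |(t - (k * h + τ)) / h| ≤ 1 := by
    rw [abs_of_nonneg (div_nonneg (by linarith) hh.le), div_le_one hh]
    linarith
  rw [hx.eq_of_mem hh hτ (k := k) ⟨by linarith, by linarith⟩ i, Real.norm_eq_abs, add_sub_right_comm]
  refine (abs_add_le _ _).trans (add_le_add_right ?_ _)
  rw [abs_mul]
  exact mul_le_of_le_one_right (abs_nonneg _) h3

end Trajectory

theorem delayBound_le_one {V : Type*} (δ σ : V → ℝ) : delayBound δ σ ≤ 1 := min_le_left _ _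

theorem delayBound_le {V : Type*} [Fintype V] (δ σ : V → ℝ) (i : V) :
    delayBound δ σ ≤ (1 - 2 * δ i - σ i) / (4 * δ i) :=
  (min_le_right _ _).trans (ciInf_le (Set.finite_range _).bddBelow i)

end EventConsensus

theorem theorem4 {V : Type*} [Fintype V] (G : Digraph V)
    (hloop : ∀ v, ¬ G.Adj v v)
    (htree : EventConsensus.HasSpanningTree G)
    (δ σ : V → ℝ) (hδ : ∀ i, 0 < δ i ∧ δ i < 1 / 2)
    (hσ : ∀ i, 0 < σ i ∧ σ i < 1 - 2 * δ i) :
    (∃! ξ : EventConsensus.RootNode G → ℝ, EventConsensus.IsPositiveLeftNull G ξ) ∧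
    ∀ h : ℝ, 0 < h → ∀ τ : ℝ, 0 < τ → τ < h * EventConsensus.delayBound δ σ →
      ∀ (E : V → Set ℕ) (x : V → ℝ → ℝ), EventConsensus.IsTrajectory G δ σ h τ E x →
        EventConsensus.ReachesConsensus x ∧
        ∀ ξ : EventConsensus.RootNode G → ℝ, EventConsensus.IsPositiveLeftNull G ξ →
          ∀ i, Tendsto (x i) atTop
            (𝓝 (EventConsensus.consensusValue G δ ξ (fun j => x j 0))) := by
  have hex := EventConsensus.existsUnique_isPositiveLeftNull hloop htree
  refine ⟨hex, fun h hh τ hτ hτβ E x hx => ?_⟩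
  have hτh : τ < h := hτβ.trans_le
    (mul_le_of_le_one_right hh.le (EventConsensus.delayBound_le_one δ σ))
  have hdelay : ∀ i, 4 * δ i * (τ / h) < 1 - 2 * δ i - σ i := by
    intro i
    have h1 : τ / h < (1 - 2 * δ i - σ i) / (4 * δ i) :=
      ((div_lt_iff₀' hh).2 hτβ).trans_le (EventConsensus.delayBound_le δ σ i)
    exact (lt_div_iff₀' (by linarith [(hδ i).1])).1 h1
  have hlim : ∀ ξ : EventConsensus.RootNode G → ℝ, EventConsensus.IsPositiveLeftNull G ξ →
      ∀ i, Tendsto (x i) atTop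
        (𝓝 (EventConsensus.consensusValue G δ ξ (fun j => x j 0))) := by
    intro ξ hξ i
    have hs := hx.isSampledSystem hh hτ hτh fun i => (hσ i).1
    have hc := hs.tendsto hloop htree (fun i => (hδ i).1) (fun i => (hσ i).1)
      (div_nonneg hτ.le hh.le) hdelay hξ i
    have h0 : (fun j => x j ((0 : ℕ) * h + τ)) = fun j => x j 0 := by
      funext j
      rw [Nat.cast_zero, zero_mul, zero_add, hx.eq_initial hτ j]
    rw [h0] at hc
    exact hx.tendsto hh hτ hc.1 hc.2
  obtain ⟨ξ, hξ, -⟩ := hex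
  exact ⟨fun i j => by simpa using (hlim ξ hξ i).sub (hlim ξ hξ j), hlim⟩
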